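/- Let $d\ge 1$, let $\{|i\rangle\}_{i\in\mathbb Z_d}$ be the standard basis of $\mathbb C^d$, and let $U$ be the Fourier transform of $\mathbb Z_d$, i.e. the unitary with $U|k\rangle=\frac1{\sqrt d}\sum_{j\in\mathbb Z_d}e^{2\pi\mathrm{i}jk/d}|j\rangle$. For a density matrix $\rho$ write $S(\rho)=-\operatorname{Tr}\rho\log_2\rho$, and for an ensemble $\mathcal E=\{p_i,\rho_i\}$ of density matrices write $\chi(\mathcal E)=S\bigl(\sum_i p_i\rho_i\bigr)-\sum_i p_iS(\rho_i)$. Let $\Lambda$ be any completely positive and trace preserving linear map from the operators on $\mathbb C^d$ to the operators on an arbitrary finite-dimensional Hilbert space, and consider the ensembles $$\Lambda(\mathcal E_0)=\Bigl\{\tfrac1d,\Lambda(|i\rangle\langle i|)\Bigr\}_{i\in\mathbb Z_d},\qquad \Lambda(\mathcal E_1)=\Bigl\{\tfrac1d,\Lambda(U|i\rangle\langle i|U^\dagger)\Bigr\}_{i\in\mathbb Z_d}.$$ Then $$\chi\bigl(\Lambda(\mathcal E_0)\bigr)+\chi\bigl(\Lambda(\mathcal E_1)\bigr)\le I(\tau;\Lambda):=S(\tau)+S\bigl(\Lambda(\tau)\bigr)-S\bigl((\mathrm{id}\otimes\Lambda)\Phi_d\bigr),$$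 where $\tau=\frac1d\mathbb 1$ and $\Phi_d=|\varphi\rangle\langle\varphi|$ with $|\varphi\rangle=\frac1{\sqrt d}\sum_{i\in\mathbb Z_d}|i\rangle\otimes|i\rangle$. -/

import Mathlib

open scoped Matrix ComplexOrder

noncomputable section

namespace QInfo

/-- The von Neumann entropy `S(ρ) = -Tr (ρ log₂ ρ)`, in bits: `Real.negMulLog` is the function
`x ↦ -x * log x` (with value `0` at `0`), applied to the Hermitian matrix `ρ` by the functional
calculus. -/
def entropy {n : Type*} [Fintype n] [DecidableEq n] (ρ : Matrix n n ℂ) : ℝ :=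
  (cfc Real.negMulLog ρ).trace.re / Real.log 2

/-- The operator `|v⟩⟨v|`. -/
def ketbra {n : Type*} (v : n → ℂ) : Matrix n n ℂ :=
  Matrix.vecMulVec v (star v)

/-- The map `id ⊗ Λ`, where `id` is the identity on the matrices indexed by `k`: it applies `Λ` to
each block `M (a, ·) (b, ·)`. -/
def idTensor (k : Type*) {n m : Type*} (Λ : Matrix n n ℂ →ₗ[ℂ] Matrix m m ℂ)
    (M : Matrix (k × n) (k × n) ℂ) : Matrix (k × m) (k × m) ℂ :=
  Matrix.of fun x y => Λ (Matrix.of fun i j => M (x.1, i) (y.1, j)) x.2 y.2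

/-- Completely positive and trace preserving linear maps. -/
structure IsCPTP {n m : Type*} [Fintype n] [Fintype m]
    (Λ : Matrix n n ℂ →ₗ[ℂ] Matrix m m ℂ) : Prop where
  completelyPositive : ∀ (k : ℕ) (M : Matrix (Fin k × n) (Fin k × n) ℂ),
    M.PosSemidef → (idTensor (Fin k) Λ M).PosSemidef
  tracePreserving : ∀ M : Matrix n n ℂ, (Λ M).trace = M.trace

/-- The Holevo information `χ = S(∑ i, p i • ρ i) - ∑ i, p i * S(ρ i)` of the ensemble
`{p i, ρ i}`. -/
def holevo {ι n : Type*} [Fintype ι] [Fintype n] [DecidableEq n]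
    (p : ι → ℝ) (ρ : ι → Matrix n n ℂ) : ℝ :=
  entropy (∑ i, (p i : ℂ) • ρ i) - ∑ i, p i * entropy (ρ i)

/-- The quantum Fourier transform of `ℤ/d`, the matrix with entries
`exp (2 π i j k / d) / √d`. -/
def fourier (d : ℕ) [NeZero d] : Matrix (ZMod d) (ZMod d) ℂ :=
  Matrix.of fun j k => ZMod.stdAddChar (j * k) / (Real.sqrt d : ℂ)

/-- The computational basis vector `|i⟩`. -/
def ket {d : ℕ} (i : ZMod d) : ZMod d → ℂ :=
  Pi.single i 1

/-- The maximally mixed state `τ`. -/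
def maxMixed (d : ℕ) : Matrix (ZMod d) (ZMod d) ℂ :=
  (1 / (d : ℂ)) • 1

/-- The maximally entangled state `Φ = |φ⟩⟨φ|`, with `|φ⟩ = (1 / √d) ∑ i, |i⟩ ⊗ |i⟩`. -/
def maxEntangled (d : ℕ) : Matrix (ZMod d × ZMod d) (ZMod d × ZMod d) ℂ :=
  ketbra fun x => if x.1 = x.2 then 1 / (Real.sqrt d : ℂ) else 0

/-- The quantum mutual information of `Λ` on the maximally mixed input,
`I(τ; Λ) = S(τ) + S(Λ(τ)) - S((id ⊗ Λ) Φ)`. -/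
def mutualInfo {d : ℕ} [NeZero d] {m : Type*} [Fintype m] [DecidableEq m]
    (Λ : Matrix (ZMod d) (ZMod d) ℂ →ₗ[ℂ] Matrix m m ℂ) : ℝ :=
  entropy (maxMixed d) + entropy (Λ (maxMixed d)) -
    entropy (idTensor (ZMod d) Λ (maxEntangled d))

end QInfo

end

/-! Let `σ` be the Choi state `(id ⊗ Λ) Φ`. Averaging over clock operators on the reference dephases
it in the standard basis, leaving blocks `Λ(|i⟩⟨i|) / d`. Averaging over shifts dephases it in the
Fourier basis, leaving blocks `Λ(U|i⟩⟨i|U†) / d`. The averages commute, and together they give `τ ⊗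
Λ(τ)`. The entropies of these three states are `log d` plus, respectively, the two ensemble averages
of output entropies and `S(Λ(τ))`. The theorem is therefore `S(σ) + S(𝒰𝒱σ) ≤ S(𝒰σ) + S(𝒱σ)` for the
two averages `𝒰`, `𝒱` (`natEntropy_add_twirl_twirl_le`).

Since `𝒱` is a pinching, `D(σ‖𝒱σ) = S(𝒱σ) - S(σ)` (`relEntropy_twirl`), so this inequality is
monotonicity of `D` under `𝒰` for the pair `(σ, 𝒱σ)`. Monotonicity (`relEntropy_twirl_le`) comes
from writing `D` as an integral of maxima over `X` of functionals linear in the pair of states.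
Conjugating both states by a unitary only reparametrizes `X`, and a maximum of averages is at most
the average of maxima. -/

noncomputable section

namespace QInfo

/-! ### Relative entropy and its monotonicity under mixtures of unitaries. -/

section RelativeEntropy

variable {n : Type*} [Fintype n]

/-- The average of the conjugates of a matrix by a family of matrices. -/
def twirl {ι : Type*} [Fintype ι] (U : ι → Matrix n n ℂ) (M : Matrix n n ℂ) : Matrix n n ℂ :=
  (((Fintype.card ι : ℝ)⁻¹ : ℝ) : ℂ) • ∑ k, U k * M * (U k)ᴴ

lemma re_trace_mul_twirl {ι : Type*} [Fintype ι] (U : ι → Matrix n n ℂ)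
    (A M : Matrix n n ℂ) : (A * twirl U M).trace.re =
      (Fintype.card ι : ℝ)⁻¹ * ∑ k, (A * (U k * M * (U k)ᴴ)).trace.re := by
  rw [twirl, Matrix.mul_smul, Matrix.trace_smul, smul_eq_mul,
    Complex.re_ofReal_mul, Matrix.mul_sum, Matrix.trace_sum, Complex.re_sum]

lemma isHermitian_twirl {ι : Type*} [Fintype ι] {U : ι → Matrix n n ℂ} {M : Matrix n n ℂ}
    (hM : M.IsHermitian) : (twirl U M).IsHermitian := by
  rw [Matrix.IsHermitian, twirl, Matrix.conjTranspose_smul, Matrix.conjTranspose_sum]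
  congr 1
  · simp
  · exact Finset.sum_congr rfl fun k _ => Matrix.isHermitian_mul_mul_conjTranspose _ hM

variable [DecidableEq n]

/-- The matrix of inner products between the eigenbases of two Hermitian matrices. -/
def overlap {ρ σ : Matrix n n ℂ} (hρ : ρ.IsHermitian) (hσ : σ.IsHermitian) : Matrix n n ℂ :=
  star (hρ.eigenvectorUnitary : Matrix n n ℂ) * (hσ.eigenvectorUnitary : Matrix n n ℂ)

/-- The quadratic functional whose maximum over `X` is the integrand in the integral
representation of the relative entropy. -/
def quadForm (s : ℝ) (ρ σ X : Matrix n n ℂ) : ℝ :=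
  2 * (Xᴴ * (ρ - σ)).trace.re - (1 - s) * (Xᴴ * ρ * X).trace.re - s * (X * σ * Xᴴ).trace.re

/-- The maximum of `quadForm`, in terms of the eigenvalues. -/
def quadMax (s : ℝ) {ρ σ : Matrix n n ℂ} (hρ : ρ.IsHermitian) (hσ : σ.IsHermitian) : ℝ :=
  ∑ i, ∑ j, Complex.normSq (overlap hρ hσ i j) *
    ((hρ.eigenvalues i - hσ.eigenvalues j) ^ 2 /
      ((1 - s) * hρ.eigenvalues i + s * hσ.eigenvalues j))

lemma cfc_eq_conj {A : Matrix n n ℂ} (hA : A.IsHermitian) (f : ℝ → ℝ) :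
    cfc f A = (hA.eigenvectorUnitary : Matrix n n ℂ) *
      Matrix.diagonal (fun i => (f (hA.eigenvalues i) : ℂ)) *
        (hA.eigenvectorUnitary : Matrix n n ℂ)ᴴ := by
  rw [hA.cfc_eq, Matrix.IsHermitian.cfc, Unitary.conjStarAlgAut_apply]
  rfl

lemma eq_conj {A : Matrix n n ℂ} (hA : A.IsHermitian) :
    A = (hA.eigenvectorUnitary : Matrix n n ℂ) *
      Matrix.diagonal (fun i => (hA.eigenvalues i : ℂ)) *
        (hA.eigenvectorUnitary : Matrix n n ℂ)ᴴ := by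
  conv_lhs => rw [← cfc_id' ℝ A hA.isSelfAdjoint, cfc_eq_conj hA]

lemma trace_diagonal_mul_mul_diagonal (a b : n → ℝ) (W : Matrix n n ℂ) :
    (Matrix.diagonal (fun i => (a i : ℂ)) * W * Matrix.diagonal (fun i => (b i : ℂ)) * Wᴴ).trace.re
      = ∑ i, ∑ j, Complex.normSq (W i j) * (a i * b j) := by
  simp only [Matrix.trace, Matrix.diag_apply, Matrix.mul_apply (M := _ * _ * _), Complex.re_sum,
    Matrix.mul_diagonal, Matrix.diagonal_mul, Matrix.conjTranspose_apply]
  refine Finset.sum_congr rfl fun i _ => Finset.sum_congr rfl fun j _ => ?_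
  have : (a i : ℂ) * W i j * b j * star (W i j) =
      ((Complex.normSq (W i j) * (a i * b j) : ℝ) : ℂ) := by
    push_cast
    rw [← Complex.mul_conj]
    simp only [Complex.star_def]
    ring
  rw [this, Complex.ofReal_re]

lemma trace_cfc_mul_cfc {ρ σ : Matrix n n ℂ} (hρ : ρ.IsHermitian) (hσ : σ.IsHermitian)
    (f g : ℝ → ℝ) :
    (cfc f ρ * cfc g σ).trace.re = ∑ i, ∑ j, Complex.normSq (overlap hρ hσ i j) *
      (f (hρ.eigenvalues i) * g (hσ.eigenvalues j)) := by
  rw [← trace_diagonal_mul_mul_diagonal (fun i => f (hρ.eigenvalues i))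
    (fun j => g (hσ.eigenvalues j)), cfc_eq_conj hρ, cfc_eq_conj hσ, overlap,
    Matrix.conjTranspose_mul, Matrix.star_eq_conjTranspose, Matrix.conjTranspose_conjTranspose,
    Matrix.mul_assoc, Matrix.mul_assoc, Matrix.trace_mul_comm]
  simp only [Matrix.mul_assoc]

/-- With rows of `Y` in the eigenbasis of `ρ` and columns in that of `σ`, the form decouples into
one scalar quadratic per entry, so it can be maximized entrywise. -/
lemma quadForm_conj_eigenbases (s : ℝ) {ρ σ : Matrix n n ℂ} (hρ : ρ.IsHermitian)
    (hσ : σ.IsHermitian) (Y : Matrix n n ℂ) :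
    quadForm s ρ σ ((hρ.eigenvectorUnitary : Matrix n n ℂ) * Y *
        (hσ.eigenvectorUnitary : Matrix n n ℂ)ᴴ) =
      ∑ i, ∑ j, (2 * ((hρ.eigenvalues i - hσ.eigenvalues j) *
          (star (Y i j) * overlap hρ hσ i j).re) -
        ((1 - s) * hρ.eigenvalues i + s * hσ.eigenvalues j) * Complex.normSq (Y i j)) := by
  set U := (hρ.eigenvectorUnitary : Matrix n n ℂ) with hU
  set V := (hσ.eigenvectorUnitary : Matrix n n ℂ) with hV
  set a := hρ.eigenvalues with ha
  set b := hσ.eigenvalues with hb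
  have hUU : Uᴴ * U = 1 := Unitary.coe_star_mul_self hρ.eigenvectorUnitary
  have hVV : Vᴴ * V = 1 := Unitary.coe_star_mul_self hσ.eigenvectorUnitary
  have hUU' (M : Matrix n n ℂ) : Uᴴ * (U * M) = M := by rw [← Matrix.mul_assoc, hUU, Matrix.one_mul]
  have hVV' (M : Matrix n n ℂ) : Vᴴ * (V * M) = M := by rw [← Matrix.mul_assoc, hVV, Matrix.one_mul]
  have hW : overlap hρ hσ = Uᴴ * V := rfl
  have eρ : ρ = U * Matrix.diagonal (fun i => (a i : ℂ)) * Uᴴ := eq_conj hρ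
  have eσ : σ = V * Matrix.diagonal (fun i => (b i : ℂ)) * Vᴴ := eq_conj hσ
  have h2 : ((U * Y * Vᴴ)ᴴ * ρ * (U * Y * Vᴴ)).trace.re =
      ∑ i, ∑ j, Complex.normSq (Y i j) * (a i * 1) := by
    rw [← trace_diagonal_mul_mul_diagonal a (fun _ => 1)]
    conv_lhs => rw [eρ]
    simp only [Matrix.conjTranspose_mul, Matrix.conjTranspose_conjTranspose, Matrix.mul_assoc,
      hUU']
    rw [Matrix.trace_mul_comm]
    simp only [Matrix.mul_assoc, hVV, Matrix.mul_one]
    rw [Matrix.trace_mul_comm]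
    simp [Matrix.mul_assoc]
  have h3 : ((U * Y * Vᴴ) * σ * (U * Y * Vᴴ)ᴴ).trace.re =
      ∑ i, ∑ j, Complex.normSq (Y i j) * (1 * b j) := by
    rw [← trace_diagonal_mul_mul_diagonal (fun _ => 1) b]
    conv_lhs => rw [eσ]
    simp only [Matrix.conjTranspose_mul, Matrix.conjTranspose_conjTranspose, Matrix.mul_assoc,
      hVV']
    rw [Matrix.trace_mul_comm]
    simp [Matrix.mul_assoc, hUU]
  have h1 : ((U * Y * Vᴴ)ᴴ * (ρ - σ)).trace.re =
      ∑ i, ∑ j, (a i - b j) * (star (Y i j) * overlap hρ hσ i j).re := by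
    have e : ((U * Y * Vᴴ)ᴴ * (ρ - σ)).trace = (Yᴴ * (Matrix.diagonal (fun i => (a i : ℂ)) *
        overlap hρ hσ - overlap hρ hσ * Matrix.diagonal (fun i => (b i : ℂ)))).trace := by
      rw [hW]
      conv_lhs => rw [eρ, eσ]
      simp only [Matrix.conjTranspose_mul, Matrix.conjTranspose_conjTranspose]
      rw [Matrix.mul_assoc, Matrix.trace_mul_comm]
      simp only [Matrix.mul_assoc, Matrix.mul_sub, Matrix.sub_mul, hUU', hVV, Matrix.mul_one]
    rw [e, Matrix.trace_mul_comm]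
    simp only [Matrix.trace, Matrix.diag_apply, Matrix.mul_apply (M := _ - _), Complex.re_sum,
      Matrix.sub_apply, Matrix.mul_diagonal, Matrix.diagonal_mul, Matrix.conjTranspose_apply]
    refine Finset.sum_congr rfl fun i _ => Finset.sum_congr rfl fun j _ => ?_
    rw [← Complex.re_ofReal_mul]
    congr 1
    push_cast
    ring
  rw [quadForm, h1, h2, h3]
  simp only [Finset.mul_sum, ← Finset.sum_sub_distrib]
  refine Finset.sum_congr rfl fun i _ => Finset.sum_congr rfl fun j _ => ?_
  ring

lemma convexComb_pos {s a b : ℝ} (hs : s ∈ Set.Icc (0 : ℝ) 1) (ha : 0 < a) (hb : 0 < b) :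
    0 < (1 - s) * a + s * b := by
  obtain ⟨h0, h1⟩ := hs
  rcases h0.eq_or_lt with rfl | h
  · simpa
  · have := mul_nonneg (sub_nonneg.2 h1) ha.le
    positivity

lemma quadForm_le_quadMax {s : ℝ} (hs : s ∈ Set.Icc (0 : ℝ) 1) {ρ σ : Matrix n n ℂ}
    (hρ : ρ.PosDef) (hσ : σ.PosDef) (X : Matrix n n ℂ) :
    quadForm s ρ σ X ≤ quadMax s hρ.1 hσ.1 := by
  have hX : X = (hρ.1.eigenvectorUnitary : Matrix n n ℂ) *
      ((hρ.1.eigenvectorUnitary : Matrix n n ℂ)ᴴ * X * (hσ.1.eigenvectorUnitary : Matrix n n ℂ)) *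
        (hσ.1.eigenvectorUnitary : Matrix n n ℂ)ᴴ := by
    have h1 : (hρ.1.eigenvectorUnitary : Matrix n n ℂ) *
        (hρ.1.eigenvectorUnitary : Matrix n n ℂ)ᴴ = 1 :=
      Unitary.coe_mul_star_self hρ.1.eigenvectorUnitary
    have h2 : (hσ.1.eigenvectorUnitary : Matrix n n ℂ) *
        (hσ.1.eigenvectorUnitary : Matrix n n ℂ)ᴴ = 1 :=
      Unitary.coe_mul_star_self hσ.1.eigenvectorUnitary
    simp only [← Matrix.mul_assoc, h1, Matrix.one_mul]
    rw [Matrix.mul_assoc, h2, Matrix.mul_one]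
  rw [hX, quadForm_conj_eigenbases, quadMax]
  refine Finset.sum_le_sum fun i _ => Finset.sum_le_sum fun j _ => ?_
  have hc := convexComb_pos hs (hρ.eigenvalues_pos i) (hσ.eigenvalues_pos j)
  generalize (1 - s) * hρ.1.eigenvalues i + s * hσ.1.eigenvalues j = c at hc ⊢
  generalize hρ.1.eigenvalues i - hσ.1.eigenvalues j = t
  generalize overlap hρ.1 hσ.1 i j = w
  generalize (_ * _ : Matrix n n ℂ) i j = y
  rw [mul_div_assoc', le_div_iff₀ hc]
  simp only [Complex.star_def, Complex.normSq_apply, Complex.mul_re, Complex.conj_re,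
    Complex.conj_im]
  -- Completing the square: after multiplication by `c`, the gap is `|t w - c y|²`.
  nlinarith [sq_nonneg (t * w.re - c * y.re), sq_nonneg (t * w.im - c * y.im)]

lemma exists_quadForm_eq_quadMax {s : ℝ} (hs : s ∈ Set.Icc (0 : ℝ) 1) {ρ σ : Matrix n n ℂ}
    (hρ : ρ.PosDef) (hσ : σ.PosDef) : ∃ X, quadForm s ρ σ X = quadMax s hρ.1 hσ.1 := by
  -- The entrywise maximizer `y = t w / c`, where the completed square vanishes.
  refine ⟨(hρ.1.eigenvectorUnitary : Matrix n n ℂ) * (Matrix.of fun i j =>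
    (((hρ.1.eigenvalues i - hσ.1.eigenvalues j) /
      ((1 - s) * hρ.1.eigenvalues i + s * hσ.1.eigenvalues j) : ℝ) : ℂ) * overlap hρ.1 hσ.1 i j) *
        (hσ.1.eigenvectorUnitary : Matrix n n ℂ)ᴴ, ?_⟩
  rw [quadForm_conj_eigenbases, quadMax]
  refine Finset.sum_congr rfl fun i _ => Finset.sum_congr rfl fun j _ => ?_
  have hc := convexComb_pos hs (hρ.eigenvalues_pos i) (hσ.eigenvalues_pos j)
  rw [Matrix.of_apply]
  generalize (1 - s) * hρ.1.eigenvalues i + s * hσ.1.eigenvalues j = c at hc ⊢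
  generalize hρ.1.eigenvalues i - hσ.1.eigenvalues j = t
  generalize overlap hρ.1 hσ.1 i j = w
  simp only [Complex.star_def, Complex.normSq_apply, Complex.mul_re, Complex.mul_im,
    Complex.conj_re, Complex.conj_im, Complex.ofReal_re, Complex.ofReal_im]
  field_simp
  ring

section Twirl

variable {ι : Type*} [Fintype ι] {U : ι → Matrix n n ℂ}

lemma mul_conjTranspose_of_conjTranspose_mul {V : Matrix n n ℂ} (h : Vᴴ * V = 1) :
    V * Vᴴ = 1 := mul_eq_one_comm.1 h

/-- The form is linear in `(ρ, σ)`, and by cyclicity of the trace a unitary conjugation of both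
states can be moved onto `X`. -/
lemma quadForm_twirl (s : ℝ) (ρ σ X : Matrix n n ℂ) (hU : ∀ k, (U k)ᴴ * U k = 1) :
    quadForm s (twirl U ρ) (twirl U σ) X =
      (Fintype.card ι : ℝ)⁻¹ * ∑ k, quadForm s ρ σ ((U k)ᴴ * X * U k) := by
  have hUU (k : ι) := mul_conjTranspose_of_conjTranspose_mul (hU k)
  have h1 (A : Matrix n n ℂ) : (Xᴴ * twirl U A).trace.re =
      (Fintype.card ι : ℝ)⁻¹ * ∑ k, (((U k)ᴴ * X * U k)ᴴ * A).trace.re := by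
    rw [re_trace_mul_twirl]
    congr 1
    refine Finset.sum_congr rfl fun k _ => ?_
    rw [← Matrix.mul_assoc, Matrix.trace_mul_comm]
    simp only [Matrix.conjTranspose_mul, Matrix.conjTranspose_conjTranspose, Matrix.mul_assoc]
  have h2 : (Xᴴ * twirl U ρ * X).trace.re = (Fintype.card ι : ℝ)⁻¹ *
      ∑ k, (((U k)ᴴ * X * U k)ᴴ * ρ * ((U k)ᴴ * X * U k)).trace.re := by
    rw [Matrix.trace_mul_comm, ← Matrix.mul_assoc, re_trace_mul_twirl]
    congr 1
    refine Finset.sum_congr rfl fun k _ => ?_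
    have e : ((U k)ᴴ * X * U k)ᴴ * ρ * ((U k)ᴴ * X * U k) =
        (U k)ᴴ * (Xᴴ * (U k * ρ * (U k)ᴴ) * X * U k) := by
      simp only [Matrix.conjTranspose_mul, Matrix.conjTranspose_conjTranspose, Matrix.mul_assoc]
    rw [e, Matrix.trace_mul_comm (U k)ᴴ, Matrix.mul_assoc _ (U k), hUU, Matrix.mul_one,
      Matrix.mul_assoc X, Matrix.trace_mul_comm X]
  have h3 : (X * twirl U σ * Xᴴ).trace.re = (Fintype.card ι : ℝ)⁻¹ *
      ∑ k, (((U k)ᴴ * X * U k) * σ * ((U k)ᴴ * X * U k)ᴴ).trace.re := by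
    rw [Matrix.trace_mul_comm, ← Matrix.mul_assoc, re_trace_mul_twirl]
    congr 1
    refine Finset.sum_congr rfl fun k _ => ?_
    have e : ((U k)ᴴ * X * U k) * σ * ((U k)ᴴ * X * U k)ᴴ =
        (U k)ᴴ * (X * (U k * σ * (U k)ᴴ) * Xᴴ * U k) := by
      simp only [Matrix.conjTranspose_mul, Matrix.conjTranspose_conjTranspose, Matrix.mul_assoc]
    rw [e, Matrix.trace_mul_comm (U k)ᴴ, Matrix.mul_assoc _ (U k), hUU, Matrix.mul_one,
      Matrix.mul_assoc Xᴴ, Matrix.trace_mul_comm Xᴴ]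
  rw [quadForm, Matrix.mul_sub, Matrix.trace_sub, Complex.sub_re, h1, h1, h2, h3]
  simp only [quadForm, Matrix.mul_sub, Matrix.trace_sub, Complex.sub_re,
    Finset.sum_sub_distrib, ← Finset.mul_sum]
  ring

variable [Nonempty ι]

lemma posDef_twirl (hU : ∀ k, (U k)ᴴ * U k = 1) {M : Matrix n n ℂ} (hM : M.PosDef) :
    (twirl U M).PosDef := by
  have h (k : ι) : (U k * M * (U k)ᴴ).PosDef := by
    refine hM.mul_mul_conjTranspose_same (B := U k) ?_
    refine Function.LeftInverse.injective (g := fun v => v ᵥ* (U k)ᴴ) fun v => ?_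
    simp [mul_conjTranspose_of_conjTranspose_mul (hU k)]
  refine Matrix.PosDef.smul ?_ ?_
  · exact Matrix.posDef_sum Finset.univ_nonempty fun k _ => h k
  · have : (0 : ℝ) < (Fintype.card ι : ℝ)⁻¹ := by
      have := Fintype.card_pos (α := ι)
      positivity
    exact_mod_cast this

lemma quadMax_twirl_le {s : ℝ} (hs : s ∈ Set.Icc (0 : ℝ) 1) (hU : ∀ k, (U k)ᴴ * U k = 1)
    {ρ σ : Matrix n n ℂ} (hρ : ρ.PosDef) (hσ : σ.PosDef) :
    quadMax s (posDef_twirl hU hρ).1 (posDef_twirl hU hσ).1 ≤ quadMax s hρ.1 hσ.1 := by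
  -- The optimal `X` for the averaged pair, conjugated by each `U k`, is a competitor for the
  -- original pair.
  obtain ⟨X, hX⟩ := exists_quadForm_eq_quadMax hs (posDef_twirl hU hρ) (posDef_twirl hU hσ)
  have hc : (0 : ℝ) < Fintype.card ι := by exact_mod_cast Fintype.card_pos
  rw [← hX, quadForm_twirl s ρ σ X hU, inv_mul_le_iff₀ hc]
  calc _ ≤ ∑ _k : ι, quadMax s hρ.1 hσ.1 :=
        Finset.sum_le_sum fun k _ => quadForm_le_quadMax hs hρ hσ _
    _ = _ := by simp

end Twirl

/-! ### Integral representation of the relative entropy. -/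

lemma continuousOn_integrand {a b : ℝ} (ha : 0 < a) (hb : 0 < b) :
    ContinuousOn (fun s : ℝ => s * ((a - b) ^ 2 / ((1 - s) * a + s * b))) (Set.uIcc 0 1) := by
  rw [Set.uIcc_of_le zero_le_one]
  refine continuousOn_id.mul (ContinuousOn.div (by fun_prop) (by fun_prop) fun s hs => ?_)
  exact (convexComb_pos hs ha hb).ne'

lemma integral_integrand {a b : ℝ} (ha : 0 < a) (hb : 0 < b) :
    ∫ s in (0 : ℝ)..1, s * ((a - b) ^ 2 / ((1 - s) * a + s * b)) =
      a * Real.log a - a * Real.log b - a + b := by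
  rw [intervalIntegral.integral_eq_sub_of_hasDerivAt
    -- With `c = (1 - s) a + s b` one has `s (b - a) = c - a`, so the integrand is `(b - a) - a (b -
    -- a) / c`, and `b - a` is the derivative of `c`.
    (f := fun s => (b - a) * s - a * Real.log ((1 - s) * a + s * b)) ?_
    (continuousOn_integrand ha hb).intervalIntegrable]
  · simp
    ring
  · intro s hs
    rw [Set.uIcc_of_le zero_le_one] at hs
    have hc := (convexComb_pos hs ha hb).ne'
    have h1 : HasDerivAt (fun s : ℝ => (1 - s) * a + s * b) (b - a) s := by
      refine ((((hasDerivAt_id' s).const_sub 1).mul_const a).add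
        ((hasDerivAt_id' s).mul_const b)).congr_deriv ?_
      ring
    refine (((hasDerivAt_id' s).const_mul (b - a)).sub ((h1.log hc).const_mul a)).congr_deriv ?_
    rw [mul_div_assoc', mul_div_assoc', eq_div_iff hc, sub_mul, div_mul_cancel₀ _ hc]
    ring

/-- The quantum relative entropy, in nats, with the correction that makes it nonnegative on pairs
of positive matrices of different traces. -/
def relEntropy (ρ σ : Matrix n n ℂ) : ℝ :=
  (cfc (fun x => x * Real.log x) ρ).trace.re - (ρ * cfc Real.log σ).trace.re - ρ.trace.re +
    σ.trace.re

/-- All four traces are sums over pairs of eigenvalues with the same weights, the squared overlaps,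
which reduces the claim to the scalar `integral_integrand`. -/
lemma relEntropy_eq_integral {ρ σ : Matrix n n ℂ} (hρ : ρ.PosDef) (hσ : σ.PosDef) :
    relEntropy ρ σ = ∫ s in (0 : ℝ)..1, s * quadMax s hρ.1 hσ.1 := by
  have hid {A : Matrix n n ℂ} (hA : A.PosDef) : cfc (fun x : ℝ => x) A = A :=
    cfc_id' ℝ A hA.1.isSelfAdjoint
  have hone {A : Matrix n n ℂ} (hA : A.PosDef) : cfc (fun _ : ℝ => (1 : ℝ)) A = 1 :=
    cfc_const_one ℝ A hA.1.isSelfAdjoint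
  have h1 := trace_cfc_mul_cfc hρ.1 hσ.1 (fun x => x * Real.log x) (fun _ => 1)
  have h2 := trace_cfc_mul_cfc hρ.1 hσ.1 (fun x => x) Real.log
  have h3 := trace_cfc_mul_cfc hρ.1 hσ.1 (fun x => x) (fun _ => 1)
  have h4 := trace_cfc_mul_cfc hρ.1 hσ.1 (fun _ => 1) (fun x => x)
  simp only [hid hρ, hid hσ, hone hρ, hone hσ, Matrix.mul_one, Matrix.one_mul] at h1 h2 h3 h4
  rw [relEntropy, h1, h2, h3, h4]
  simp only [quadMax, Finset.mul_sum, mul_left_comm _ (Complex.normSq _)]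
  have hint (i j : n) := (continuousOn_integrand (hρ.eigenvalues_pos i)
    (hσ.eigenvalues_pos j)).intervalIntegrable (μ := MeasureTheory.volume)
  have integrable_sum (i : n) : IntervalIntegrable (fun s : ℝ => ∑ j,
      Complex.normSq (overlap hρ.1 hσ.1 i j) * (s * ((hρ.1.eigenvalues i - hσ.1.eigenvalues j) ^ 2 /
        ((1 - s) * hρ.1.eigenvalues i + s * hσ.1.eigenvalues j)))) MeasureTheory.volume 0 1 := by
    simpa only [Finset.sum_fn] using
      IntervalIntegrable.sum Finset.univ fun j _ => (hint i j).const_mul _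
  rw [intervalIntegral.integral_finsetSum fun i _ =>
    integrable_sum i]
  simp only [← Finset.sum_sub_distrib, ← Finset.sum_add_distrib]
  refine Finset.sum_congr rfl fun i _ => ?_
  rw [intervalIntegral.integral_finsetSum fun j _ => (hint i j).const_mul _]
  refine Finset.sum_congr rfl fun j _ => ?_
  rw [intervalIntegral.integral_const_mul,
    integral_integrand (hρ.eigenvalues_pos i) (hσ.eigenvalues_pos j)]
  ring

lemma intervalIntegrable_quadMax {ρ σ : Matrix n n ℂ} (hρ : ρ.PosDef) (hσ : σ.PosDef) :
    IntervalIntegrable (fun s => s * quadMax s hρ.1 hσ.1) MeasureTheory.volume 0 1 := by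
  simp only [quadMax, Finset.mul_sum, mul_left_comm _ (Complex.normSq _)]
  exact ContinuousOn.intervalIntegrable <| continuousOn_finsetSum _ fun i _ =>
    continuousOn_finsetSum _ fun j _ =>
      (continuousOn_integrand (hρ.eigenvalues_pos i) (hσ.eigenvalues_pos j)).const_mul _

/-- The relative entropy does not increase under mixtures of unitary conjugations. -/
theorem relEntropy_twirl_le {ι : Type*} [Fintype ι] [Nonempty ι] {U : ι → Matrix n n ℂ}
    (hU : ∀ k, (U k)ᴴ * U k = 1) {ρ σ : Matrix n n ℂ} (hρ : ρ.PosDef) (hσ : σ.PosDef) :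
    relEntropy (twirl U ρ) (twirl U σ) ≤ relEntropy ρ σ := by
  rw [relEntropy_eq_integral hρ hσ,
    relEntropy_eq_integral (posDef_twirl hU hρ) (posDef_twirl hU hσ)]
  refine intervalIntegral.integral_mono_on zero_le_one
    (intervalIntegrable_quadMax (posDef_twirl hU hρ) (posDef_twirl hU hσ))
    (intervalIntegrable_quadMax hρ hσ) fun s hs => ?_
  exact mul_le_mul_of_nonneg_left (quadMax_twirl_le hs hU hρ hσ) hs.1

end RelativeEntropy

/-! ### Entropy calculus and strong subadditivity for commuting twirls. -/

section StrongSubadditivity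

variable {n : Type*} [Fintype n] [DecidableEq n]

/-- The von Neumann entropy in nats. -/
def natEntropy (ρ : Matrix n n ℂ) : ℝ := (cfc Real.negMulLog ρ).trace.re

lemma entropy_eq (ρ : Matrix n n ℂ) : entropy ρ = natEntropy ρ / Real.log 2 := rfl

lemma trace_cfc {A : Matrix n n ℂ} (hA : A.IsHermitian) (f : ℝ → ℝ) :
    (cfc f A).trace.re = ∑ i, f (hA.eigenvalues i) := by
  rw [cfc_eq_conj hA, Matrix.trace_mul_comm, ← Matrix.mul_assoc]
  have h : (hA.eigenvectorUnitary : Matrix n n ℂ)ᴴ * (hA.eigenvectorUnitary : Matrix n n ℂ) = 1 :=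
    Unitary.coe_star_mul_self hA.eigenvectorUnitary
  rw [h, Matrix.one_mul, Matrix.trace_diagonal, Complex.re_sum]
  simp

/-- Roots of the characteristic polynomial form a multiset, so unitary invariance and block
additivity follow from polynomial identities, with no matching of indexed eigenvalues. -/
lemma trace_cfc_eq_roots {A : Matrix n n ℂ} (hA : A.IsHermitian) (f : ℝ → ℝ) :
    (cfc f A).trace.re = (A.charpoly.roots.map fun z => f z.re).sum := by
  rw [trace_cfc hA, hA.roots_charpoly_eq_eigenvalues, Multiset.map_map]
  simp

lemma natEntropy_mul_mul_conjTranspose {A V : Matrix n n ℂ} (hA : A.IsHermitian)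
    (hV : Vᴴ * V = 1) : natEntropy (V * A * Vᴴ) = natEntropy A := by
  have hA' : (V * A * Vᴴ).IsHermitian := Matrix.isHermitian_mul_mul_conjTranspose V hA
  rw [natEntropy, natEntropy, trace_cfc_eq_roots hA, trace_cfc_eq_roots hA',
    Matrix.charpoly_mul_comm, ← Matrix.mul_assoc, hV, Matrix.one_mul]

lemma charpoly_blockDiagonal {m k R : Type*} [CommRing R] [Fintype m] [DecidableEq m] [Fintype k]
    [DecidableEq k] (M : k → Matrix m m R) :
    (Matrix.blockDiagonal M).charpoly = ∏ a, (M a).charpoly := by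
  have : (Matrix.blockDiagonal M).charmatrix =
      Matrix.blockDiagonal fun a => (M a).charmatrix := by
    ext ⟨x, a⟩ ⟨y, b⟩ : 2
    by_cases h : a = b
    · subst h
      by_cases hxy : x = y
      · subst hxy
        simp
      · simp [Matrix.blockDiagonal_apply, hxy]
    · simp [Matrix.blockDiagonal_apply, h]
  rw [Matrix.charpoly, this, Matrix.det_blockDiagonal]
  rfl

lemma natEntropy_of_blocks {m k : Type*} [Fintype m] [DecidableEq m] [Fintype k]
    [DecidableEq k] {A : Matrix (k × m) (k × m) ℂ} {M : k → Matrix m m ℂ}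
    (hM : ∀ a, (M a).IsHermitian)
    (h : ∀ a x b y, A (a, x) (b, y) = if a = b then M a x y else 0) :
    natEntropy A = ∑ a, natEntropy (M a) := by
  have hA : A.IsHermitian := by
    ext ⟨a, x⟩ ⟨b, y⟩
    rw [Matrix.conjTranspose_apply, h, h]
    by_cases hab : a = b
    · subst hab
      simpa using (hM a).apply x y
    · simp [hab, Ne.symm hab]
  have hB : A = Matrix.reindex (Equiv.prodComm m k) (Equiv.prodComm m k)
      (Matrix.blockDiagonal M) := by
    ext ⟨a, x⟩ ⟨b, y⟩
    simp [h, Matrix.blockDiagonal_apply]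
  have hroots : A.charpoly.roots = Finset.univ.val.bind fun a => (M a).charpoly.roots := by
    rw [hB, Matrix.charpoly_reindex, charpoly_blockDiagonal, Polynomial.roots_prod]
    exact Finset.prod_ne_zero_iff.2 fun a _ => (Matrix.charpoly_monic _).ne_zero
  rw [natEntropy, trace_cfc_eq_roots hA, hroots, Multiset.map_bind, Multiset.sum_bind]
  simp only [natEntropy, trace_cfc_eq_roots (hM _)]
  rfl

lemma re_trace_eq_sum_eigenvalues {A : Matrix n n ℂ} (hA : A.IsHermitian) :
    A.trace.re = ∑ i, hA.eigenvalues i := by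
  conv_lhs => rw [← cfc_id' ℝ A hA.isSelfAdjoint]
  rw [trace_cfc hA]

lemma natEntropy_smul {A : Matrix n n ℂ} (hA : A.IsHermitian) (c : ℝ) :
    natEntropy ((c : ℂ) • A) = c * natEntropy A + Real.negMulLog c * A.trace.re := by
  have h : cfc Real.negMulLog ((c : ℂ) • A) = cfc (fun x => Real.negMulLog (c * x)) A := by
    rw [cfc_comp' Real.negMulLog (fun x => c * x) A Real.continuous_negMulLog.continuousOn
      (by fun_prop) hA.isSelfAdjoint, cfc_const_mul_id c A hA.isSelfAdjoint]
    simp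
  rw [natEntropy, h, trace_cfc hA, natEntropy, trace_cfc hA, re_trace_eq_sum_eigenvalues hA,
    Finset.mul_sum, Finset.mul_sum, ← Finset.sum_add_distrib]
  refine Finset.sum_congr rfl fun i _ => ?_
  rw [Real.negMulLog_mul]
  ring

-- Carries the inequality from positive definite to positive semidefinite matrices; continuity of
-- `Real.negMulLog` at `0` is what makes it work.
open Filter Topology in
lemma tendsto_natEntropy_add_smul_one {A : Matrix n n ℂ} (hA : A.IsHermitian) :
    Tendsto (fun ε : ℝ => natEntropy (A + (ε : ℂ) • 1)) (𝓝[>] 0) (𝓝 (natEntropy A)) := by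
  have h (ε : ℝ) : natEntropy (A + (ε : ℂ) • 1) =
      ∑ i, Real.negMulLog (hA.eigenvalues i + ε) := by
    have : cfc Real.negMulLog (A + (ε : ℂ) • 1) = cfc (fun x => Real.negMulLog (x + ε)) A := by
      rw [cfc_comp' Real.negMulLog (fun x => x + ε) A Real.continuous_negMulLog.continuousOn
        (by fun_prop) hA.isSelfAdjoint, cfc_add_const ε (fun x => x) A (by fun_prop)
        hA.isSelfAdjoint, cfc_id' ℝ A hA.isSelfAdjoint, Algebra.algebraMap_eq_smul_one]
      simp
    rw [natEntropy, this, trace_cfc hA]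
  have hc : Continuous fun ε : ℝ => ∑ i, Real.negMulLog (hA.eigenvalues i + ε) :=
    continuous_finsetSum _ fun i _ => Real.continuous_negMulLog.comp (by fun_prop)
  have := hc.tendsto 0
  simp only [← h] at this
  simpa using this.mono_left nhdsWithin_le_nhds

variable {ι κ : Type*} [Fintype ι] [Nonempty ι] [Fintype κ] [Nonempty κ]
  {U : ι → Matrix n n ℂ} {V : κ → Matrix n n ℂ}

/-- Each unitary passes through `L` and cancels under the trace. Used with `L = 1` for trace
preservation and with `L` the logarithm of the twirled state. -/
lemma re_trace_twirl_mul_of_commute (hV : ∀ k, (V k)ᴴ * V k = 1) (ρ : Matrix n n ℂ)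
    {L : Matrix n n ℂ} (hL : ∀ k, Commute L (V k)) :
    (twirl V ρ * L).trace.re = (ρ * L).trace.re := by
  have hc : (Fintype.card κ : ℝ) ≠ 0 := by exact_mod_cast Fintype.card_ne_zero
  have e (k : κ) : (L * (V k * ρ * (V k)ᴴ)).trace = (ρ * L).trace := by
    rw [← Matrix.mul_assoc, ← Matrix.mul_assoc, (hL k).eq, Matrix.trace_mul_comm,
      ← Matrix.mul_assoc, ← Matrix.mul_assoc, hV, Matrix.one_mul, Matrix.trace_mul_comm]
  rw [Matrix.trace_mul_comm, re_trace_mul_twirl]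
  simp only [e, Finset.sum_const, Finset.card_univ, nsmul_eq_mul]
  rw [inv_mul_cancel_left₀ hc]

/-- The logarithm of the twirled state commutes with every `V k`, so in the cross term `σ` may be
replaced by its twirl; the traces agree, and two entropies remain. -/
lemma relEntropy_twirl (hV : ∀ k, (V k)ᴴ * V k = 1) {σ : Matrix n n ℂ} (hσ : σ.PosDef)
    (hc : ∀ k, Commute (twirl V σ) (V k)) :
    relEntropy σ (twirl V σ) = natEntropy (twirl V σ) - natEntropy σ := by
  have hE := posDef_twirl hV hσ
  have htr : (twirl V σ).trace.re = σ.trace.re := by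
    simpa using re_trace_twirl_mul_of_commute hV σ (L := 1) fun k => Commute.one_left _
  have hlog : (σ * cfc Real.log (twirl V σ)).trace.re =
      (cfc (fun x => x * Real.log x) (twirl V σ)).trace.re := by
    rw [← re_trace_twirl_mul_of_commute hV σ fun k => (hc k).cfc_real _,
      cfc_mul (fun x => x) Real.log (twirl V σ) (by fun_prop)
        (Matrix.finite_real_spectrum.continuousOn _), cfc_id' ℝ _ hE.1.isSelfAdjoint]
  have hneg {A : Matrix n n ℂ} (hA : A.IsHermitian) :
      (cfc (fun x => x * Real.log x) A).trace.re = -natEntropy A := by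
    rw [natEntropy, trace_cfc hA, trace_cfc hA, ← Finset.sum_neg_distrib]
    simp [Real.negMulLog]
  rw [relEntropy, hlog, htr, hneg hσ.1, hneg hE.1]
  ring

/-- Strong subadditivity for a pair of commuting twirls, on positive definite matrices. -/
lemma natEntropy_add_twirl_twirl_le_of_posDef (hU : ∀ k, (U k)ᴴ * U k = 1)
    (hV : ∀ k, (V k)ᴴ * V k = 1) (hc : ∀ M k, Commute (twirl V M) (V k))
    (hUV : ∀ M, twirl U (twirl V M) = twirl V (twirl U M)) {σ : Matrix n n ℂ} (hσ : σ.PosDef) :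
    natEntropy σ + natEntropy (twirl U (twirl V σ)) ≤
      natEntropy (twirl U σ) + natEntropy (twirl V σ) := by
  have h := relEntropy_twirl_le hU hσ (posDef_twirl hV hσ)
  -- Commutation of the twirls makes the left side the divergence of `twirl U σ` from its own
  -- `V`-twirl, so both sides become entropy differences.
  rw [hUV, relEntropy_twirl hV hσ (hc _), relEntropy_twirl hV (posDef_twirl hU hσ) (hc _)] at h
  rw [hUV]
  linarith

lemma twirl_add_smul_one (hU : ∀ k, (U k)ᴴ * U k = 1) (M : Matrix n n ℂ) (c : ℂ) :
    twirl U (M + c • 1) = twirl U M + c • 1 := by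
  have hc : (Fintype.card ι : ℂ) ≠ 0 := by exact_mod_cast Fintype.card_ne_zero
  simp only [twirl, Matrix.mul_add, Matrix.add_mul, Finset.sum_add_distrib, smul_add,
    Matrix.mul_smul, Matrix.smul_mul, Matrix.mul_one,
    mul_conjTranspose_of_conjTranspose_mul (hU _), Finset.sum_const, Finset.card_univ]
  rw [← Nat.cast_smul_eq_nsmul ℂ, smul_smul]
  simp [hc]

/-- Strong subadditivity for a pair of commuting twirls. -/
theorem natEntropy_add_twirl_twirl_le (hU : ∀ k, (U k)ᴴ * U k = 1)
    (hV : ∀ k, (V k)ᴴ * V k = 1) (hc : ∀ M k, Commute (twirl V M) (V k))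
    (hUV : ∀ M, twirl U (twirl V M) = twirl V (twirl U M)) {σ : Matrix n n ℂ}
    (hσ : σ.PosSemidef) :
    natEntropy σ + natEntropy (twirl U (twirl V σ)) ≤
      natEntropy (twirl U σ) + natEntropy (twirl V σ) := by
  have hV' := isHermitian_twirl (U := V) hσ.1
  refine le_of_tendsto_of_tendsto
    ((tendsto_natEntropy_add_smul_one hσ.1).add
      (tendsto_natEntropy_add_smul_one (isHermitian_twirl (U := U) hV')))
    ((tendsto_natEntropy_add_smul_one (isHermitian_twirl (U := U) hσ.1)).add
      (tendsto_natEntropy_add_smul_one hV')) ?_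
  filter_upwards [self_mem_nhdsWithin] with ε hε
  have hpos : (σ + (ε : ℂ) • (1 : Matrix n n ℂ)).PosDef :=
    Matrix.PosDef.posSemidef_add hσ
      (Matrix.PosDef.one.smul (by exact_mod_cast (Set.mem_Ioi.1 hε)))
  have := natEntropy_add_twirl_twirl_le_of_posDef hU hV hc hUV hpos
  simpa only [twirl_add_smul_one hU, twirl_add_smul_one hV] using this

end StrongSubadditivity

/-! ### Positivity of channel outputs. -/

section Channel

variable {n m : Type*} [Fintype n] [Fintype m] {Λ : Matrix n n ℂ →ₗ[ℂ] Matrix m m ℂ}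

lemma posSemidef_ketbra (v : n → ℂ) : (ketbra v).PosSemidef :=
  Matrix.posSemidef_vecMulVec_self_star v

lemma IsCPTP.posSemidef_idTensor (hΛ : IsCPTP Λ) {k : Type*} [Fintype k]
    {M : Matrix (k × n) (k × n) ℂ} (hM : M.PosSemidef) : (idTensor k Λ M).PosSemidef := by
  let e := (Fintype.equivFin k).symm
  have h := hΛ.completelyPositive (Fintype.card k) _
    (hM.submatrix fun x : Fin (Fintype.card k) × n => (e x.1, x.2))
  convert h.submatrix fun x : k × m => (e.symm x.1, x.2) using 1
  ext ⟨a, x⟩ ⟨b, y⟩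
  simp [idTensor]

lemma IsCPTP.posSemidef_map (hΛ : IsCPTP Λ) {M : Matrix n n ℂ} (hM : M.PosSemidef) :
    (Λ M).PosSemidef := by
  have h := hΛ.posSemidef_idTensor (k := Unit) (hM.submatrix fun x : Unit × n => x.2)
  exact h.submatrix fun x : m => ((), x)

end Channel

/-! ### Clock and shift twirls as dephasings in the standard and Fourier bases. -/

section Fourier

lemma sqrt_mul_sqrt_natCast (d : ℕ) : ((√(d : ℝ) : ℝ) : ℂ) * ((√(d : ℝ) : ℝ) : ℂ) = d := by
  rw [← Complex.ofReal_mul, Real.mul_self_sqrt (Nat.cast_nonneg d), Complex.ofReal_natCast]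

variable (d : ℕ) [NeZero d]

lemma sum_stdAddChar_mul (a b : ZMod d) :
    ∑ k, (ZMod.stdAddChar (k * a) : ℂ) * star (ZMod.stdAddChar (k * b) : ℂ) =
      if a = b then (d : ℂ) else 0 := by
  have h := AddChar.sum_mulShift (a - b) (ZMod.isPrimitive_stdAddChar d)
  rw [ZMod.card] at h
  simp only [sub_eq_zero, Nat.cast_ite, Nat.cast_zero] at h
  rw [← h]
  refine Finset.sum_congr rfl fun k _ => ?_
  rw [Complex.star_def, ← AddChar.map_neg_eq_conj, ← AddChar.map_add_eq_mul]
  congr 1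
  ring

lemma fourier_conjTranspose_mul : (fourier d)ᴴ * fourier d = 1 := by
  have hd : (d : ℂ) ≠ 0 := NeZero.ne _
  rw [mul_eq_one_comm]
  ext i j
  have e (k : ZMod d) : fourier d i k * star (fourier d j k) =
      (d : ℂ)⁻¹ * (ZMod.stdAddChar (k * i) * star (ZMod.stdAddChar (k * j) : ℂ)) := by
    rw [← sqrt_mul_sqrt_natCast, fourier, Matrix.of_apply, Matrix.of_apply, mul_comm i,
      mul_comm j]
    simp only [star_div₀, Complex.star_def, Complex.conj_ofReal]
    field_simp
  rw [Matrix.mul_apply]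
  simp only [Matrix.conjTranspose_apply, e, ← Finset.mul_sum, sum_stdAddChar_mul]
  simp [Matrix.one_apply, hd]

variable (m : Type*) [Fintype m] [DecidableEq m]

/-- The powers of the clock operator `Z`, on the first factor. -/
def clock (k : ZMod d) : Matrix (ZMod d × m) (ZMod d × m) ℂ :=
  Matrix.diagonal fun x => ZMod.stdAddChar (k * x.1)

/-- The powers of the shift operator `X`, on the first factor. -/
def shift (k : ZMod d) : Matrix (ZMod d × m) (ZMod d × m) ℂ :=
  (1 : Matrix (ZMod d × m) (ZMod d × m) ℂ).submatrix (fun x => (x.1 + k, x.2)) id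

lemma clock_conjTranspose_mul (k : ZMod d) :
    (clock d m k)ᴴ * clock d m k = 1 := by
  rw [clock, Matrix.diagonal_conjTranspose, Matrix.diagonal_mul_diagonal, ← Matrix.diagonal_one]
  congr 1
  ext x
  rw [Pi.star_apply, Complex.star_def, ← AddChar.map_neg_eq_conj, ← AddChar.map_add_eq_mul]
  simp

lemma shift_mul_mul_apply (k : ZMod d) (M : Matrix (ZMod d × m) (ZMod d × m) ℂ)
    (x y : ZMod d × m) :
    (shift d m k * M * (shift d m k)ᴴ) x y = M (x.1 + k, x.2) (y.1 + k, y.2) := by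
  simp [shift, Matrix.mul_apply, Matrix.one_apply]

lemma shift_conjTranspose_mul (k : ZMod d) :
    (shift d m k)ᴴ * shift d m k = 1 := by
  rw [mul_eq_one_comm]
  ext x y
  have := shift_mul_mul_apply d m k 1 x y
  rw [Matrix.mul_one] at this
  rw [this]
  simp [Matrix.one_apply, Prod.ext_iff]

lemma twirl_clock_apply (M : Matrix (ZMod d × m) (ZMod d × m) ℂ) (x y : ZMod d × m) :
    twirl (clock d m) M x y = if x.1 = y.1 then M x y else 0 := by
  have hd : (d : ℂ) ≠ 0 := NeZero.ne _
  have e (k : ZMod d) : (clock d m k * M * (clock d m k)ᴴ) x y =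
      (ZMod.stdAddChar (k * x.1) * star (ZMod.stdAddChar (k * y.1) : ℂ)) * M x y := by
    rw [clock, Matrix.diagonal_conjTranspose, Matrix.mul_diagonal, Matrix.diagonal_mul,
      Pi.star_apply]
    ring
  simp only [twirl, Matrix.smul_apply, Matrix.sum_apply, e, ← Finset.sum_mul,
    sum_stdAddChar_mul, ZMod.card]
  split_ifs <;> simp [hd]

lemma twirl_shift_apply (M : Matrix (ZMod d × m) (ZMod d × m) ℂ) (x y : ZMod d × m) :
    twirl (shift d m) M x y = (d : ℂ)⁻¹ * ∑ k, M (x.1 + k, x.2) (y.1 + k, y.2) := by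
  simp [twirl, Matrix.smul_apply, Matrix.sum_apply, shift_mul_mul_apply]

lemma commute_twirl_clock (M : Matrix (ZMod d × m) (ZMod d × m) ℂ) (k : ZMod d) :
    Commute (twirl (clock d m) M) (clock d m k) := by
  ext x y
  rw [clock, Matrix.mul_diagonal, Matrix.diagonal_mul, twirl_clock_apply]
  split_ifs with h
  · rw [h, mul_comm]
  · simp

lemma twirl_shift_twirl_clock (M : Matrix (ZMod d × m) (ZMod d × m) ℂ) :
    twirl (shift d m) (twirl (clock d m) M) = twirl (clock d m) (twirl (shift d m) M) := by
  ext x y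
  simp only [twirl_shift_apply, twirl_clock_apply, add_left_inj]
  split_ifs <;> simp

/-- The quantum Fourier transform on the first factor. -/
def fourierLeft : Matrix (ZMod d × m) (ZMod d × m) ℂ :=
  Matrix.kroneckerMap (· * ·) (fourier d) 1

lemma fourierLeft_conjTranspose_mul :
    (fourierLeft d m)ᴴ * fourierLeft d m = 1 := by
  rw [fourierLeft, Matrix.conjTranspose_kronecker, ← Matrix.mul_kronecker_mul,
    fourier_conjTranspose_mul, Matrix.conjTranspose_one, Matrix.mul_one, Matrix.one_kronecker_one]

lemma fourierLeft_conj_apply (M : Matrix (ZMod d × m) (ZMod d × m) ℂ) (p q : ZMod d) (x y : m) :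
    (fourierLeft d m * M * (fourierLeft d m)ᴴ) (p, x) (q, y) =
      ∑ b, ∑ a, fourier d p a * M (a, x) (b, y) * star (fourier d q b) := by
  simp [fourierLeft, Matrix.mul_apply, Fintype.sum_prod_type, Matrix.one_apply, Finset.sum_mul,
    apply_ite]

/-- The Fourier transform diagonalizes the shifts, so the shift average becomes a pinching.
Translating an index multiplies a Fourier entry by a character, and orthogonality of characters
removes the blocks with `p ≠ q`. -/
lemma fourierLeft_conj_twirl_shift_apply (M : Matrix (ZMod d × m) (ZMod d × m) ℂ)
    (p q : ZMod d) (x y : m) :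
    (fourierLeft d m * twirl (shift d m) M * (fourierLeft d m)ᴴ) (p, x) (q, y) =
      if p = q then ∑ b, ∑ a, fourier d p a * M (a, x) (b, y) * star (fourier d p b) else 0 := by
  have hd : (d : ℂ) ≠ 0 := NeZero.ne _
  have hs (p a k : ZMod d) : fourier d p (a - k) =
      fourier d p a * star (ZMod.stdAddChar (k * p) : ℂ) := by
    rw [fourier, Matrix.of_apply, Matrix.of_apply, Complex.star_def, ← AddChar.map_neg_eq_conj,
      div_mul_eq_mul_div, ← AddChar.map_add_eq_mul]
    congr 2
    ring
  calc _ = ∑ k, ∑ b, ∑ a, (d : ℂ)⁻¹ *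
        (fourier d p a * M (a + k, x) (b + k, y) * star (fourier d q b)) := by
        rw [fourierLeft_conj_apply]
        symm
        rw [Finset.sum_comm]
        refine Finset.sum_congr rfl fun b _ => ?_
        rw [Finset.sum_comm]
        refine Finset.sum_congr rfl fun a _ => ?_
        rw [twirl_shift_apply, Finset.mul_sum, Finset.mul_sum, Finset.sum_mul]
        refine Finset.sum_congr rfl fun k _ => ?_
        ring
    _ = ∑ k, ∑ b, ∑ a, (d : ℂ)⁻¹ *
        (fourier d p (a - k) * M (a, x) (b, y) * star (fourier d q (b - k))) := by
        refine Finset.sum_congr rfl fun k _ => ?_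
        refine Fintype.sum_equiv (Equiv.addRight k) _ _ fun b => ?_
        refine Fintype.sum_equiv (Equiv.addRight k) _ _ fun a => ?_
        simp
    _ = (d : ℂ)⁻¹ * (∑ k, (ZMod.stdAddChar (k * q) : ℂ) * star (ZMod.stdAddChar (k * p) : ℂ)) *
        ∑ b, ∑ a, fourier d p a * M (a, x) (b, y) * star (fourier d q b) := by
        rw [mul_assoc, Finset.sum_mul, Finset.mul_sum]
        refine Finset.sum_congr rfl fun k _ => ?_
        rw [Finset.mul_sum, Finset.mul_sum]
        refine Finset.sum_congr rfl fun b _ => ?_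
        rw [Finset.mul_sum, Finset.mul_sum]
        refine Finset.sum_congr rfl fun a _ => ?_
        rw [hs, hs, star_mul', star_star]
        ring
    _ = _ := by
        rw [sum_stdAddChar_mul]
        by_cases h : p = q
        · subst h
          simp [hd]
        · simp [h, Ne.symm h]

end Fourier

/-! ### The Choi state, the entropies of its twirls, and the Holevo quantities. -/

section Choi

lemma ketbra_ket {d : ℕ} (i : ZMod d) : ketbra (ket i) = Matrix.single i i 1 := by
  ext a b
  by_cases ha : a = i <;> by_cases hb : b = i <;>
    simp [ketbra, ket, Matrix.vecMulVec_apply, ha, hb, Ne.symm]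

lemma posSemidef_maxMixed (d : ℕ) : (maxMixed d).PosSemidef := by
  refine Matrix.PosSemidef.one.smul ?_
  rw [one_div]
  exact inv_nonneg.2 (Nat.cast_nonneg d)

variable {d : ℕ} {m : Type*}
  (Λ : Matrix (ZMod d) (ZMod d) ℂ →ₗ[ℂ] Matrix m m ℂ)

lemma idTensor_maxEntangled_apply (a b : ZMod d) (x y : m) :
    idTensor (ZMod d) Λ (maxEntangled d) (a, x) (b, y) =
      (d : ℂ)⁻¹ * Λ (Matrix.single a b 1) x y := by
  have h : (Matrix.of fun i j => maxEntangled d (a, i) (b, j)) =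
      (d : ℂ)⁻¹ • Matrix.single a b 1 := by
    ext i j
    rw [← sqrt_mul_sqrt_natCast]
    by_cases ha : a = i <;> by_cases hb : b = j <;>
      simp [maxEntangled, ketbra, Matrix.vecMulVec_apply, ha, hb]
  rw [idTensor, Matrix.of_apply, h, map_smul]
  rfl

variable [NeZero d]

lemma map_apply_eq_sum (M : Matrix (ZMod d) (ZMod d) ℂ) (x y : m) :
    Λ M x y = ∑ a, ∑ b, M a b * Λ (Matrix.single a b 1) x y := by
  conv_lhs => rw [Matrix.matrix_eq_sum_single M]
  simp only [map_sum, Matrix.sum_apply]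
  refine Finset.sum_congr rfl fun a _ => Finset.sum_congr rfl fun b _ => ?_
  have h : Matrix.single a b (M a b) = M a b • Matrix.single a b (1 : ℂ) := by
    rw [Matrix.smul_single, smul_eq_mul, mul_one]
  rw [h, map_smul]
  rfl

variable {Λ} [Fintype m] [DecidableEq m]

/-- The grouping rule for a uniform classical register: each block, of weight `1 / d` and unit
trace, contributes `(log d) / d` besides its scaled entropy. -/
lemma natEntropy_of_uniform_blocks {A : Matrix (ZMod d × m) (ZMod d × m) ℂ}
    {ρ : ZMod d → Matrix m m ℂ} (hρ : ∀ a, (ρ a).IsHermitian) (htr : ∀ a, (ρ a).trace = 1)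
    (h : ∀ a x b y, A (a, x) (b, y) = if a = b then (d : ℂ)⁻¹ * ρ a x y else 0) :
    natEntropy A = Real.log d + (d : ℝ)⁻¹ * ∑ a, natEntropy (ρ a) := by
  have hd : (d : ℝ) ≠ 0 := NeZero.ne _
  have hc : (d : ℂ)⁻¹ = (((d : ℝ)⁻¹ : ℝ) : ℂ) := by simp
  rw [natEntropy_of_blocks (M := fun a => (((d : ℝ)⁻¹ : ℝ) : ℂ) • ρ a)
    (fun a => ?_) (fun a x b y => ?_)]
  · simp only [natEntropy_smul (hρ _), htr, Finset.sum_add_distrib, ← Finset.mul_sum]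
    simp only [Real.negMulLog, Complex.one_re, mul_one, Finset.sum_const, Finset.card_univ,
      ZMod.card, nsmul_eq_mul, Real.log_inv]
    field_simp
    ring
  · rw [Matrix.IsHermitian, Matrix.conjTranspose_smul, hρ a]
    simp
  · rw [h, hc]
    rfl

lemma natEntropy_maxMixed : natEntropy (maxMixed d) = Real.log d := by
  have hd : (d : ℝ) ≠ 0 := NeZero.ne _
  have h1 : natEntropy (1 : Matrix (ZMod d) (ZMod d) ℂ) = 0 := by
    simp [natEntropy, cfc_apply_one]
  have hc : 1 / (d : ℂ) = (((d : ℝ)⁻¹ : ℝ) : ℂ) := by simp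
  rw [maxMixed, hc, natEntropy_smul Matrix.isHermitian_one, h1, Matrix.trace_one, ZMod.card]
  simp only [Real.negMulLog, Real.log_inv, Complex.natCast_re]
  field_simp
  ring

lemma posSemidef_maxEntangled (d : ℕ) [NeZero d] : (maxEntangled d).PosSemidef :=
  posSemidef_ketbra _

lemma trace_ketbra (v : ZMod d → ℂ) : (ketbra v).trace = star v ⬝ᵥ v := by
  rw [ketbra, Matrix.trace_vecMulVec, dotProduct_comm]

lemma trace_ketbra_ket (i : ZMod d) : (ketbra (ket i)).trace = 1 := by
  rw [trace_ketbra]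
  simp [ket]

lemma trace_ketbra_fourier (i : ZMod d) : (ketbra (fourier d *ᵥ ket i)).trace = 1 := by
  rw [trace_ketbra, Matrix.star_mulVec, Matrix.dotProduct_mulVec, Matrix.vecMul_vecMul,
    fourier_conjTranspose_mul, Matrix.vecMul_one, ← trace_ketbra, trace_ketbra_ket]

lemma trace_maxMixed : (maxMixed d).trace = 1 := by
  have hd : (d : ℂ) ≠ 0 := NeZero.ne _
  rw [maxMixed, Matrix.trace_smul, Matrix.trace_one, ZMod.card, smul_eq_mul, one_div,
    inv_mul_cancel₀ hd]

/-- The dephased blocks carry row `i` of the Fourier matrix, while `U|i⟩` is its column `i`;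
symmetry of the matrix identifies them, so no complex conjugate of the ensemble appears. -/
lemma ketbra_fourier_apply (i a b : ZMod d) :
    ketbra (fourier d *ᵥ ket i) a b = fourier d i a * star (fourier d i b) := by
  have hsymm (a : ZMod d) : fourier d a i = fourier d i a := by
    rw [fourier, Matrix.of_apply, Matrix.of_apply, mul_comm]
  simp [ketbra, ket, Matrix.vecMulVec_apply, hsymm]

lemma sum_ketbra_ket : ∑ i : ZMod d, ((1 / (d : ℝ) : ℝ) : ℂ) • ketbra (ket i) = maxMixed d := by
  rw [← Finset.smul_sum, maxMixed]
  congr 1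
  · simp
  · simp only [ketbra_ket]
    ext a b
    simp [Matrix.sum_apply, Matrix.single_apply, Matrix.one_apply, ite_and]

lemma sum_ketbra_fourier :
    ∑ i : ZMod d, ((1 / (d : ℝ) : ℝ) : ℂ) • ketbra (fourier d *ᵥ ket i) = maxMixed d := by
  rw [← Finset.smul_sum, maxMixed]
  congr 1
  · simp
  · ext a b
    have h := mul_conjTranspose_of_conjTranspose_mul (fourier_conjTranspose_mul d)
    rw [← h, Matrix.mul_apply]
    simp [Matrix.sum_apply, ketbra, ket, Matrix.vecMulVec_apply]

lemma holevo_eq {v : ZMod d → ZMod d → ℂ}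
    (hv : ∑ i, ((1 / (d : ℝ) : ℝ) : ℂ) • ketbra (v i) = maxMixed d) :
    holevo (fun _ : ZMod d => 1 / (d : ℝ)) (fun i => Λ (ketbra (v i))) =
      (natEntropy (Λ (maxMixed d)) - (d : ℝ)⁻¹ * ∑ i, natEntropy (Λ (ketbra (v i)))) /
        Real.log 2 := by
  have h : ∑ i, ((1 / (d : ℝ) : ℝ) : ℂ) • Λ (ketbra (v i)) = Λ (maxMixed d) := by
    rw [← hv, map_sum]
    simp only [map_smul]
  rw [holevo, h]
  simp only [entropy_eq, ← Finset.mul_sum, ← Finset.sum_div]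
  ring

lemma natEntropy_twirl_clock (hΛ : IsCPTP Λ) :
    natEntropy (twirl (clock d m) (idTensor (ZMod d) Λ (maxEntangled d))) =
      Real.log d + (d : ℝ)⁻¹ * ∑ i : ZMod d, natEntropy (Λ (ketbra (ket i))) := by
  refine natEntropy_of_uniform_blocks (fun a => (hΛ.posSemidef_map (posSemidef_ketbra _)).1)
    (fun a => by rw [hΛ.tracePreserving, trace_ketbra_ket]) fun a x b y => ?_
  rw [twirl_clock_apply, idTensor_maxEntangled_apply]
  by_cases h : a = b
  · simp [h, ketbra_ket]
  · simp [h]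

lemma natEntropy_twirl_shift (hΛ : IsCPTP Λ) :
    natEntropy (twirl (shift d m) (idTensor (ZMod d) Λ (maxEntangled d))) =
      Real.log d + (d : ℝ)⁻¹ *
        ∑ i : ZMod d, natEntropy (Λ (ketbra (fourier d *ᵥ ket i))) := by
  have hσ := hΛ.posSemidef_idTensor (posSemidef_maxEntangled d)
  rw [← natEntropy_mul_mul_conjTranspose (isHermitian_twirl hσ.1) (fourierLeft_conjTranspose_mul d m)]
  refine natEntropy_of_uniform_blocks (fun a => (hΛ.posSemidef_map (posSemidef_ketbra _)).1)
    (fun a => by rw [hΛ.tracePreserving, trace_ketbra_fourier]) fun p x q y => ?_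
  rw [fourierLeft_conj_twirl_shift_apply, Finset.sum_comm, map_apply_eq_sum]
  simp only [Finset.mul_sum, ketbra_fourier_apply, idTensor_maxEntangled_apply]
  split_ifs with h
  · refine Finset.sum_congr rfl fun a _ => Finset.sum_congr rfl fun b _ => ?_
    ring
  · rfl

lemma natEntropy_twirl_shift_twirl_clock (hΛ : IsCPTP Λ) :
    natEntropy (twirl (shift d m) (twirl (clock d m) (idTensor (ZMod d) Λ (maxEntangled d)))) =
      Real.log d + natEntropy (Λ (maxMixed d)) := by
  have hd : (d : ℝ) ≠ 0 := NeZero.ne _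
  rw [natEntropy_of_uniform_blocks (ρ := fun _ => Λ (maxMixed d))
    (fun a => (hΛ.posSemidef_map (posSemidef_maxMixed d)).1)
    (fun a => by rw [hΛ.tracePreserving, trace_maxMixed]) fun a x b y => ?_]
  · simp [hd]
  · rw [twirl_shift_apply]
    simp only [twirl_clock_apply, idTensor_maxEntangled_apply, add_left_inj]
    split_ifs with h
    · subst h
      -- Translation by `a` permutes `ZMod d`, so every diagonal block is the same multiple of
      -- `Λ(τ)`.
      have e := Equiv.sum_comp (Equiv.addLeft a) fun c => Λ (Matrix.single c c 1) x y
      simp only [Equiv.coe_addLeft] at e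
      rw [map_apply_eq_sum, ← Finset.mul_sum, e, Finset.mul_sum]
      simp [maxMixed, Matrix.one_apply]
    · simp

end Choi

end QInfo

end

theorem lemma1 (d : ℕ) [NeZero d] {m : Type*} [Fintype m] [DecidableEq m]
    (Λ : Matrix (ZMod d) (ZMod d) ℂ →ₗ[ℂ] Matrix m m ℂ) (hΛ : QInfo.IsCPTP Λ) :
    QInfo.holevo (fun _ : ZMod d => 1 / (d : ℝ))
        (fun i => Λ (QInfo.ketbra (QInfo.ket i))) +
      QInfo.holevo (fun _ : ZMod d => 1 / (d : ℝ))
        (fun i => Λ (QInfo.ketbra (QInfo.fourier d *ᵥ QInfo.ket i))) ≤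
      QInfo.mutualInfo Λ := by
  have hσ := hΛ.posSemidef_idTensor (QInfo.posSemidef_maxEntangled d)
  have h := QInfo.natEntropy_add_twirl_twirl_le (QInfo.shift_conjTranspose_mul d m)
    (QInfo.clock_conjTranspose_mul d m) (QInfo.commute_twirl_clock d m)
    (QInfo.twirl_shift_twirl_clock d m) hσ
  rw [QInfo.natEntropy_twirl_shift_twirl_clock hΛ, QInfo.natEntropy_twirl_shift hΛ,
    QInfo.natEntropy_twirl_clock hΛ] at h
  rw [QInfo.holevo_eq QInfo.sum_ketbra_ket, QInfo.holevo_eq QInfo.sum_ketbra_fourier,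
    QInfo.mutualInfo, QInfo.entropy_eq, QInfo.entropy_eq, QInfo.entropy_eq,
    QInfo.natEntropy_maxMixed, ← add_div, ← add_div, ← sub_div]
  refine div_le_div_of_nonneg_right ?_ (Real.log_nonneg one_le_two)
  -- The three twirled entropies contribute `2 log d` on the right of `h` and `log d` on the left;
  -- the surplus `log d` is `S(τ)`.
  linarith
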